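/- Let $\mathbb{H}=\mathbb{R}^3$ be the Heisenberg group with the product $(x,y,z)\cdot(x',y',z')=\bigl(x+x',\,y+y',\,z+z'+\tfrac12(xy'-x'y)\bigr)$, the Korányi gauge $|(x,y,z)|_G=\bigl((x^2+y^2)^2+16z^2\bigr)^{1/4}$ and the left-invariant Korányi metric $d_L(p,q)=|p^{-1}\cdot q|_G$. Let $\nabla_H f=(X_1f,X_2f)$ be the horizontal gradient, where $X_1=\partial_x-\tfrac y2\,\partial_z$ and $X_2=\partial_y+\tfrac x2\,\partial_z$. Let $m:\mathbb{R}\to\mathbb{R}$ be locally uniformly continuous, and let $u_0:\mathbb{H}\to\mathbb{R}$ be bounded and such that, for some $L>0$, $|u_0(p)-u_0(q)|\le L\,d_L(p,q)$ for all $p,q\in\mathbb{H}$. Let $u$ be a continuous function on $\mathbb{H}\times[0,\infty)$, bounded on $\mathbb{H}\times[0,T)$ for every $T>0$, which is a viscosity solution of $$u_t+m(|\nabla_H u|)=0\quad\text{in }\mathbb{H}\times(0,\infty),\qquad u(\cdot,0)=u_0 .$$ Here viscosity solution means: if $p\in\mathbb{H}$, $t>0$ and $\varphi$ is a function of class $C^2$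 near $(p,t)$, then $\varphi_t+m(|\nabla_H\varphi|)\le 0$ at $(p,t)$ whenever $u-\varphi$ has a local maximum at $(p,t)$, and $\varphi_t+m(|\nabla_H\varphi|)\ge 0$ at $(p,t)$ whenever $u-\varphi$ has a local minimum at $(p,t)$. Then $u$ is the only such solution, and for every $t\ge 0$ $$|u(p,t)-u(q,t)|\le L\,d_L(p,q)\qquad\text{for all }p,q\in\mathbb{H}.$$ -/

import Mathlib

open Set Filter Topology

/-- The Heisenberg group: the space `ℝ³` of points `(x, y, z)`, with the group law given below.
Its topology and its differentiable structure are those of `ℝ³`. -/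
def Heisenberg : Type := ℝ × ℝ × ℝ

namespace Heisenberg

noncomputable instance : NormedAddCommGroup Heisenberg :=
  inferInstanceAs (NormedAddCommGroup (ℝ × ℝ × ℝ))

noncomputable instance : NormedSpace ℝ Heisenberg :=
  inferInstanceAs (NormedSpace ℝ (ℝ × ℝ × ℝ))

/-- The point with coordinates `(x, y, z)`. -/
def mk (x y z : ℝ) : Heisenberg := (x, y, z)

/-- The first coordinate. -/
def x (p : Heisenberg) : ℝ := p.1

/-- The second coordinate. -/
def y (p : Heisenberg) : ℝ := p.2.1

/-- The third coordinate. -/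
def z (p : Heisenberg) : ℝ := p.2.2

theorem ext_coord {p q : Heisenberg} (hx : p.x = q.x) (hy : p.y = q.y) (hz : p.z = q.z) :
    p = q :=
  Prod.ext hx (Prod.ext hy hz)

noncomputable instance : Mul Heisenberg :=
  ⟨fun p q => mk (p.x + q.x) (p.y + q.y) (p.z + q.z + 1 / 2 * (p.x * q.y - q.x * p.y))⟩

noncomputable instance : One Heisenberg := ⟨mk 0 0 0⟩

noncomputable instance : Inv Heisenberg := ⟨fun p => mk (-p.x) (-p.y) (-p.z)⟩

@[simp] theorem x_mk (a b c : ℝ) : (mk a b c).x = a := rfl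
@[simp] theorem y_mk (a b c : ℝ) : (mk a b c).y = b := rfl
@[simp] theorem z_mk (a b c : ℝ) : (mk a b c).z = c := rfl
@[simp] theorem x_mul (p q : Heisenberg) : (p * q).x = p.x + q.x := rfl
@[simp] theorem y_mul (p q : Heisenberg) : (p * q).y = p.y + q.y := rfl
@[simp] theorem z_mul (p q : Heisenberg) :
    (p * q).z = p.z + q.z + 1 / 2 * (p.x * q.y - q.x * p.y) := rfl
@[simp] theorem x_one : (1 : Heisenberg).x = 0 := rfl
@[simp] theorem y_one : (1 : Heisenberg).y = 0 := rfl
@[simp] theorem z_one : (1 : Heisenberg).z = 0 := rfl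
@[simp] theorem x_inv (p : Heisenberg) : (p⁻¹).x = -p.x := rfl
@[simp] theorem y_inv (p : Heisenberg) : (p⁻¹).y = -p.y := rfl
@[simp] theorem z_inv (p : Heisenberg) : (p⁻¹).z = -p.z := rfl

noncomputable instance : Group Heisenberg :=
  Group.ofLeftAxioms
    (fun p q r => ext_coord (by simp; ring) (by simp; ring) (by simp; ring))
    (fun p => ext_coord (by simp) (by simp) (by simp))
    (fun p => ext_coord (by simp) (by simp) (by simp))

/-- The Korányi gauge `|p|_G = ((x² + y²)² + 16 z²)^(1/4)`. -/
noncomputable def gauge (p : Heisenberg) : ℝ :=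
  ((p.x ^ 2 + p.y ^ 2) ^ 2 + 16 * p.z ^ 2) ^ (1 / 4 : ℝ)

/-- The left-invariant Korányi metric `d_L(p, q) = |p⁻¹ · q|_G`. -/
noncomputable def dL (p q : Heisenberg) : ℝ := gauge (p⁻¹ * q)

/-- The value at `p` of the left-invariant vector field `X₁ = ∂_x - (y/2) ∂_z`. -/
noncomputable def X₁ (p : Heisenberg) : Heisenberg := mk 1 0 (-(p.y / 2))

/-- The value at `p` of the left-invariant vector field `X₂ = ∂_y + (x/2) ∂_z`. -/
noncomputable def X₂ (p : Heisenberg) : Heisenberg := mk 0 1 (p.x / 2)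

/-- The horizontal gradient `∇_H f (p) = (X₁ f (p), X₂ f (p))`, a vector of the Euclidean plane.
It is used only for functions that are differentiable at `p`. -/
noncomputable def horizontalGradient (f : Heisenberg → ℝ) (p : Heisenberg) :
    EuclideanSpace ℝ (Fin 2) :=
  !₂[fderiv ℝ f p (X₁ p), fderiv ℝ f p (X₂ p)]

/-- The expression `φ_t + m(|∇_H φ|)` at the point `(p, t)`. -/
noncomputable def hamiltonJacobi (m : ℝ → ℝ) (φ : Heisenberg × ℝ → ℝ) (p : Heisenberg) (t : ℝ) :
    ℝ :=
  deriv (fun s => φ (p, s)) t + m ‖horizontalGradient (fun q => φ (q, t)) p‖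

/-- Viscosity subsolutions of `u_t + m(|∇_H u|) = 0` in `ℍ × (0, ∞)`: upper semicontinuous
functions such that `φ_t + m(|∇_H φ|) ≤ 0` at every point of `ℍ × (0, ∞)` at which `u - φ` has a
local maximum, for every `φ` of class `C²` near this point. -/
def IsViscositySubsolution (m : ℝ → ℝ) (u : Heisenberg × ℝ → ℝ) : Prop :=
  UpperSemicontinuousOn u (univ ×ˢ Ioi 0) ∧
    ∀ (φ : Heisenberg × ℝ → ℝ) (p : Heisenberg) (t : ℝ), 0 < t → ContDiffAt ℝ 2 φ (p, t) →
      IsLocalMax (fun w => u w - φ w) (p, t) → hamiltonJacobi m φ p t ≤ 0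

/-- Viscosity supersolutions of `u_t + m(|∇_H u|) = 0` in `ℍ × (0, ∞)`. -/
def IsViscositySupersolution (m : ℝ → ℝ) (u : Heisenberg × ℝ → ℝ) : Prop :=
  LowerSemicontinuousOn u (univ ×ˢ Ioi 0) ∧
    ∀ (φ : Heisenberg × ℝ → ℝ) (p : Heisenberg) (t : ℝ), 0 < t → ContDiffAt ℝ 2 φ (p, t) →
      IsLocalMin (fun w => u w - φ w) (p, t) → 0 ≤ hamiltonJacobi m φ p t

/-- `u` is a continuous viscosity solution of `u_t + m(|∇_H u|) = 0` in `ℍ × (0, ∞)` with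
`u(·, 0) = u₀`, bounded on `ℍ × [0, T)` for every `T > 0`. The values of `u` at negative times
play no role. -/
structure IsBoundedViscositySolution (m : ℝ → ℝ) (u₀ : Heisenberg → ℝ)
    (u : Heisenberg × ℝ → ℝ) : Prop where
  continuousOn : ContinuousOn u (univ ×ˢ Ici 0)
  bounded : ∀ T : ℝ, 0 < T → ∃ C : ℝ, ∀ p : Heisenberg, ∀ t ∈ Ico 0 T, |u (p, t)| ≤ C
  initial : ∀ p : Heisenberg, u (p, 0) = u₀ p
  subsolution : IsViscositySubsolution m u
  supersolution : IsViscositySupersolution m u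

end Heisenberg

/-- Every point has a neighbourhood on which `m` is uniformly continuous. -/
def LocallyUniformlyContinuous (m : ℝ → ℝ) : Prop :=
  ∀ r : ℝ, ∃ s ∈ 𝓝 r, UniformContinuousOn m s

namespace Heisenberg

/-! Write N for the fourth power of the gauge, a polynomial. The core is a comparison principle
(`sub_le_gaugePow`): a bound u(p,0) - v(q,0) ≤ c + λN(p⁻¹q) persists in time. It is proved by
doubling variables with λ fixed. At an interior maximum the two test functions have horizontal
gradients of norm |λ∇N(p⁻¹q)| and |λ∇N(q⁻¹p) + δ∇N(p)|. The X_i are left-invariant and |∇N| is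
unchanged by inversion (`norm_gaugePowGradient_inv`), so these norms differ only by the localisation
term, which is small with δ. Both stay bounded, so continuity of m makes the Hamiltonians nearly
cancel, against a time barrier of derivative at least ω > 0.

Young's inequality bounds L·d by 3Lκ/4 + Ld⁴/(4κ³), so Lipschitz data satisfy the initial bound for
every κ > 0. Propagating it and optimising in κ gives u(p,t) - v(q,t) ≤ L·d(p,q) for any two
solutions (`sub_le_dL`). The case u = v is the Lipschitz estimate and p = q is uniqueness. -/

@[fun_prop] theorem contDiff_x {n : WithTop ℕ∞} : ContDiff ℝ n x :=
  (contDiff_fst : ContDiff ℝ n (Prod.fst : ℝ × ℝ × ℝ → ℝ))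

@[fun_prop] theorem contDiff_y {n : WithTop ℕ∞} : ContDiff ℝ n y :=
  (contDiff_fst.comp contDiff_snd : ContDiff ℝ n (fun p : ℝ × ℝ × ℝ => p.2.1))

@[fun_prop] theorem contDiff_z {n : WithTop ℕ∞} : ContDiff ℝ n z :=
  (contDiff_snd.comp contDiff_snd : ContDiff ℝ n (fun p : ℝ × ℝ × ℝ => p.2.2))

@[fun_prop] theorem continuous_x : Continuous x := (contDiff_x (n := 0)).continuous

@[fun_prop] theorem continuous_y : Continuous y := (contDiff_y (n := 0)).continuous

@[fun_prop] theorem continuous_z : Continuous z := (contDiff_z (n := 0)).continuous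

@[simp] theorem x_add (p q : Heisenberg) : (p + q).x = p.x + q.x := rfl
@[simp] theorem y_add (p q : Heisenberg) : (p + q).y = p.y + q.y := rfl
@[simp] theorem z_add (p q : Heisenberg) : (p + q).z = p.z + q.z := rfl
@[simp] theorem x_smul (c : ℝ) (p : Heisenberg) : (c • p).x = c * p.x := rfl
@[simp] theorem y_smul (c : ℝ) (p : Heisenberg) : (c • p).y = c * p.y := rfl
@[simp] theorem z_smul (c : ℝ) (p : Heisenberg) : (c • p).z = c * p.z := rfl

instance : ProperSpace Heisenberg := inferInstanceAs (ProperSpace (ℝ × ℝ × ℝ))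

theorem norm_le_of_coord {p : Heisenberg} {R : ℝ} (hx : |p.x| ≤ R) (hy : |p.y| ≤ R)
    (hz : |p.z| ≤ R) : ‖p‖ ≤ R :=
  max_le hx (max_le hy hz)

/-! ### The gauge and its sublevel sets. -/

/-- The fourth power of the Korányi gauge. -/
def gaugePow (p : Heisenberg) : ℝ := (p.x ^ 2 + p.y ^ 2) ^ 2 + 16 * p.z ^ 2

theorem gaugePow_nonneg (p : Heisenberg) : 0 ≤ gaugePow p := by
  unfold gaugePow; positivity

@[fun_prop] theorem contDiff_gaugePow {n : WithTop ℕ∞} : ContDiff ℝ n gaugePow := by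
  unfold gaugePow; fun_prop

@[fun_prop] theorem continuous_gaugePow : Continuous gaugePow :=
  (contDiff_gaugePow (n := 0)).continuous

theorem gaugePow_inv (p : Heisenberg) : gaugePow p⁻¹ = gaugePow p := by
  simp [gaugePow]

theorem gaugePow_inv_mul_comm (p q : Heisenberg) : gaugePow (p⁻¹ * q) = gaugePow (q⁻¹ * p) := by
  rw [← gaugePow_inv, mul_inv_rev, inv_inv]

@[fun_prop] theorem contDiff_gaugePow_mul {n : WithTop ℕ∞} (q : Heisenberg) :
    ContDiff ℝ n (fun p => gaugePow (q * p)) := by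
  simp only [gaugePow, x_mul, y_mul, z_mul]; fun_prop

theorem continuous_gaugePow_inv_mul :
    Continuous (fun w : Heisenberg × Heisenberg => gaugePow (w.1⁻¹ * w.2)) := by
  simp only [gaugePow, x_mul, y_mul, z_mul, x_inv, y_inv, z_inv]; fun_prop

theorem gauge_nonneg (p : Heisenberg) : 0 ≤ gauge p := by
  unfold gauge; positivity

theorem gauge_pow_four (p : Heisenberg) : gauge p ^ 4 = gaugePow p := by
  have h := gaugePow_nonneg p
  change (gaugePow p ^ (1 / 4 : ℝ)) ^ 4 = gaugePow p
  rw [← Real.rpow_natCast, ← Real.rpow_mul h]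
  norm_num

theorem dL_nonneg (p q : Heisenberg) : 0 ≤ dL p q := gauge_nonneg _

theorem dL_self (p : Heisenberg) : dL p p = 0 := by
  simp [dL, gauge]

theorem dL_comm (p q : Heisenberg) : dL p q = dL q p := by
  have h : dL p q ^ 4 = dL q p ^ 4 := by
    simp only [dL, gauge_pow_four, gaugePow_inv_mul_comm p q]
  exact (pow_left_inj₀ (dL_nonneg p q) (dL_nonneg q p) (by norm_num)).1 h

theorem le_one_add_pow_four (c : ℝ) : c ≤ 1 + c ^ 4 := by
  nlinarith [sq_nonneg (c ^ 2 - 1 / 2), sq_nonneg (c - 1 / 2)]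

theorem coord_le_of_gaugePow_le {p : Heisenberg} {a : ℝ} (h : gaugePow p ≤ a) :
    |p.x| ≤ 1 + a ∧ |p.y| ≤ 1 + a ∧ |p.z| ≤ 1 + a := by
  unfold gaugePow at h
  have key : ∀ c : ℝ, (c ^ 2) ^ 2 ≤ a → |c| ≤ 1 + a := fun c hc => by
    have h4 : |c| ^ 4 = (c ^ 2) ^ 2 := by rw [← sq_abs c]; ring
    linarith [le_one_add_pow_four |c|]
  refine ⟨key _ ?_, key _ ?_, ?_⟩
  · nlinarith [sq_nonneg p.x, sq_nonneg p.y, sq_nonneg p.z, sq_nonneg (p.x * p.y)]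
  · nlinarith [sq_nonneg p.x, sq_nonneg p.y, sq_nonneg p.z, sq_nonneg (p.x * p.y)]
  · have h1 : |p.z| ^ 2 ≤ a := by
      rw [sq_abs]; nlinarith [sq_nonneg p.z, sq_nonneg (p.x ^ 2 + p.y ^ 2)]
    nlinarith [sq_nonneg (|p.z| - 1), sq_nonneg |p.z|]

/-- Points with bounded gauge at a bounded left-invariant distance lie in a bounded set. -/
theorem exists_norm_le_of_gaugePow_le (a b : ℝ) :
    ∃ R : ℝ, ∀ p q : Heisenberg, gaugePow p ≤ a → gaugePow (p⁻¹ * q) ≤ b → ‖p‖ ≤ R ∧ ‖q‖ ≤ R := by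
  refine ⟨(1 + a) + (1 + b) + (1 + a) * (1 + b), fun p q hp hq => ?_⟩
  obtain ⟨px, py, pz⟩ := coord_le_of_gaugePow_le hp
  obtain ⟨wx, wy, wz⟩ := coord_le_of_gaugePow_le hq
  have ha : 0 ≤ 1 + a := (abs_nonneg _).trans px
  have hb : 0 ≤ 1 + b := (abs_nonneg _).trans wx
  have hab := mul_nonneg ha hb
  refine ⟨norm_le_of_coord (by linarith) (by linarith) (by linarith), ?_⟩
  -- The product term in the radius absorbs the twisted part of the third coordinate of this
  -- product.
  rw [show q = p * (p⁻¹ * q) by group]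
  set w := p⁻¹ * q
  have h1 : |p.x * w.y| ≤ (1 + a) * (1 + b) := by
    rw [abs_mul]; exact mul_le_mul px wy (abs_nonneg _) ha
  have h2 : |w.x * p.y| ≤ (1 + a) * (1 + b) := by
    rw [abs_mul, mul_comm]; exact mul_le_mul py wx (abs_nonneg _) ha
  rw [abs_le] at px py pz wx wy wz h1 h2
  refine norm_le_of_coord ?_ ?_ ?_ <;> simp only [x_mul, y_mul, z_mul, abs_le] <;>
    constructor <;> linarith [px.1, px.2, py.1, py.2, pz.1, pz.2, wx.1, wx.2, wy.1, wy.2,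
      wz.1, wz.2, h1.1, h1.2, h2.1, h2.2]

/-! ### Horizontal calculus of the gauge. -/

/-- The horizontal gradient of the fourth power of the gauge. -/
noncomputable def gaugePowGradient (p : Heisenberg) : EuclideanSpace ℝ (Fin 2) :=
  !₂[4 * p.x * (p.x ^ 2 + p.y ^ 2) - 16 * p.y * p.z, 4 * p.y * (p.x ^ 2 + p.y ^ 2) + 16 * p.x * p.z]

theorem norm_gaugePowGradient_sq (p : Heisenberg) :
    ‖gaugePowGradient p‖ ^ 2 = 16 * (p.x ^ 2 + p.y ^ 2) * gaugePow p := by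
  rw [EuclideanSpace.norm_sq_eq]
  simp [gaugePowGradient, gaugePow]
  ring

/-- The norm depends only on x² + y² and the gauge, both even. This is what lets a left-invariant
distance serve as penalty in both variables. -/
theorem norm_gaugePowGradient_inv (p : Heisenberg) :
    ‖gaugePowGradient p⁻¹‖ = ‖gaugePowGradient p‖ := by
  refine (pow_left_inj₀ (norm_nonneg _) (norm_nonneg _) two_ne_zero).1 ?_
  rw [norm_gaugePowGradient_sq, norm_gaugePowGradient_sq, gaugePow_inv]
  simp

/-- The gradient grows like N to the power 3/4, less than N itself; hence δ∇N tends to 0 with δ as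
long as δN stays bounded. -/
theorem norm_gaugePowGradient_pow_four_le (p : Heisenberg) :
    ‖gaugePowGradient p‖ ^ 4 ≤ 256 * gaugePow p ^ 3 := by
  have h : ‖gaugePowGradient p‖ ^ 4 = 256 * (p.x ^ 2 + p.y ^ 2) ^ 2 * gaugePow p ^ 2 := by
    rw [show 4 = 2 * 2 from rfl, pow_mul, norm_gaugePowGradient_sq]; ring
  have h2 : (p.x ^ 2 + p.y ^ 2) ^ 2 ≤ gaugePow p := by
    unfold gaugePow; nlinarith [sq_nonneg p.z]
  rw [h]
  nlinarith [mul_le_mul_of_nonneg_right h2 (sq_nonneg (gaugePow p))]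

theorem fderiv_gaugePow_mul_X₁ (q p : Heisenberg) :
    fderiv ℝ (fun p => gaugePow (q * p)) p (X₁ p) = gaugePowGradient (q * p) 0 := by
  have hd : DifferentiableAt ℝ (fun p => gaugePow (q * p)) p :=
    ((contDiff_gaugePow_mul (n := 1) q).differentiable one_ne_zero) p
  rw [← hd.lineDeriv_eq_fderiv, lineDeriv]
  -- Left invariance: translation by q carries the line p + tX₁(p) to the line w + tX₁(w), where w =
  -- qp.
  have h : (fun t : ℝ => gaugePow (q * (p + t • X₁ p))) = fun t : ℝ =>
      (((q * p).x + t) ^ 2 + (q * p).y ^ 2) ^ 2 + 16 * ((q * p).z - t * (q * p).y / 2) ^ 2 := by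
    funext t
    simp only [gaugePow, x_mul, y_mul, z_mul, x_add, y_add, z_add, x_smul, y_smul, z_smul, X₁,
      x_mk, y_mk, z_mk]
    ring
  rw [h]
  set w := q * p
  have hx : HasDerivAt (fun t : ℝ => w.x + t) 1 0 := (hasDerivAt_id (0 : ℝ)).const_add _
  have hz : HasDerivAt (fun t : ℝ => w.z - t * w.y / 2) (-(1 * w.y / 2)) 0 :=
    (((hasDerivAt_id (0 : ℝ)).mul_const _).div_const 2).const_sub _
  have := (((hx.pow 2).add_const (w.y ^ 2)).pow 2).add ((hz.pow 2).const_mul 16)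
  refine this.deriv.trans ?_
  simp [gaugePowGradient]
  ring

theorem fderiv_gaugePow_mul_X₂ (q p : Heisenberg) :
    fderiv ℝ (fun p => gaugePow (q * p)) p (X₂ p) = gaugePowGradient (q * p) 1 := by
  have hd : DifferentiableAt ℝ (fun p => gaugePow (q * p)) p :=
    ((contDiff_gaugePow_mul (n := 1) q).differentiable one_ne_zero) p
  rw [← hd.lineDeriv_eq_fderiv, lineDeriv]
  have h : (fun t : ℝ => gaugePow (q * (p + t • X₂ p))) = fun t : ℝ =>
      ((q * p).x ^ 2 + ((q * p).y + t) ^ 2) ^ 2 + 16 * ((q * p).z + t * (q * p).x / 2) ^ 2 := by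
    funext t
    simp only [gaugePow, x_mul, y_mul, z_mul, x_add, y_add, z_add, x_smul, y_smul, z_smul, X₂,
      x_mk, y_mk, z_mk]
    ring
  rw [h]
  set w := q * p
  have hy : HasDerivAt (fun t : ℝ => w.y + t) 1 0 := (hasDerivAt_id (0 : ℝ)).const_add _
  have hz : HasDerivAt (fun t : ℝ => w.z + t * w.x / 2) (1 * w.x / 2) 0 :=
    (((hasDerivAt_id (0 : ℝ)).mul_const _).div_const 2).const_add _
  have := (((hy.pow 2).const_add (w.x ^ 2)).pow 2).add ((hz.pow 2).const_mul 16)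
  refine this.deriv.trans ?_
  simp [gaugePowGradient]
  ring

/-- The horizontal gradient of a combination of the fourth powers of the distances to two points. -/
theorem horizontalGradient_gaugePow (a b c : ℝ) (q r p : Heisenberg) :
    horizontalGradient (fun p => a * gaugePow (q * p) + b * gaugePow (r * p) + c) p =
      a • gaugePowGradient (q * p) + b • gaugePowGradient (r * p) := by
  have hd : ∀ q : Heisenberg, DifferentiableAt ℝ (fun p => gaugePow (q * p)) p := fun q =>
    ((contDiff_gaugePow_mul (n := 1) q).differentiable one_ne_zero) p
  have hf : fderiv ℝ (fun p => a * gaugePow (q * p) + b * gaugePow (r * p) + c) p =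
      a • fderiv ℝ (fun p => gaugePow (q * p)) p + b • fderiv ℝ (fun p => gaugePow (r * p)) p :=
    ((((hd q).hasFDerivAt.const_mul a).add ((hd r).hasFDerivAt.const_mul b)).add_const c).fderiv
  ext i
  fin_cases i <;>
    simp [horizontalGradient, hf, fderiv_gaugePow_mul_X₁, fderiv_gaugePow_mul_X₂]

/-- The Hamilton–Jacobi expression of a test function with separated space and time variables. -/
theorem hamiltonJacobi_gaugePow (m : ℝ → ℝ) (a b : ℝ) (q r p : Heisenberg) {g : ℝ → ℝ} {g' t : ℝ}
    (hg : HasDerivAt g g' t) :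
    hamiltonJacobi m (fun w => a * gaugePow (q * w.1) + b * gaugePow (r * w.1) + g w.2) p t =
      g' + m ‖a • gaugePowGradient (q * p) + b • gaugePowGradient (r * p)‖ := by
  unfold hamiltonJacobi
  dsimp only
  rw [horizontalGradient_gaugePow, (hg.const_add _).deriv]

theorem contDiff_testFunction {n : WithTop ℕ∞} (a b : ℝ) (q r : Heisenberg) {g : ℝ → ℝ}
    (hg : ContDiff ℝ n g) :
    ContDiff ℝ n (fun w : Heisenberg × ℝ =>
      a * gaugePow (q * w.1) + b * gaugePow (r * w.1) + g w.2) :=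
  (((contDiff_const.mul ((contDiff_gaugePow_mul q).comp contDiff_fst)).add
    (contDiff_const.mul ((contDiff_gaugePow_mul r).comp contDiff_fst))).add (hg.comp contDiff_snd))

end Heisenberg

/-! ### Moduli of continuity on bounded sets. -/

theorem LocallyUniformlyContinuous.continuous {m : ℝ → ℝ} (hm : LocallyUniformlyContinuous m) :
    Continuous m :=
  continuous_iff_continuousAt.2 fun r =>
    let ⟨_, hs, h⟩ := hm r
    h.continuousOn.continuousAt hs

theorem exists_uniform_modulus_of_continuous {m : ℝ → ℝ} (hm : Continuous m) (R : ℝ) {ω : ℝ}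
    (hω : 0 < ω) :
    ∃ ρ > 0, ∀ a b : ℝ, |a| ≤ R → |a - b| ≤ ρ → |m a - m b| < ω := by
  have huc : UniformContinuousOn m (Metric.closedBall 0 (R + 1)) :=
    (isCompact_closedBall 0 (R + 1)).uniformContinuousOn_of_continuous hm.continuousOn
  obtain ⟨ρ, hρ, h⟩ := Metric.uniformContinuousOn_iff.1 huc ω hω
  refine ⟨min (ρ / 2) 1, by positivity, fun a b ha hab => ?_⟩
  have h1 := hab.trans (min_le_left _ _)
  have h2 := hab.trans (min_le_right _ _)
  refine h a ?_ b ?_ ?_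
  · rw [mem_closedBall_zero_iff, Real.norm_eq_abs]; linarith
  · rw [mem_closedBall_zero_iff, Real.norm_eq_abs]
    linarith [abs_sub_abs_le_abs_sub b a, abs_sub_comm a b]
  · rw [Real.dist_eq]; linarith

/-- Equicontinuity at time `0`, uniformly on bounded sets, of a continuous function. -/
theorem exists_uniform_modulus_initial {u : Heisenberg × ℝ → ℝ}
    (hu : ContinuousOn u (univ ×ˢ Ici 0)) (R T : ℝ) {θ : ℝ} (hθ : 0 < θ) :
    ∃ τ > 0, ∀ p : Heisenberg, ‖p‖ ≤ R → ∀ t ∈ Icc 0 T, t < τ → |u (p, t) - u (p, 0)| < θ := by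
  have hc : IsCompact (Metric.closedBall (0 : Heisenberg) R ×ˢ Icc (0 : ℝ) T) :=
    (isCompact_closedBall _ _).prod isCompact_Icc
  have huc := hc.uniformContinuousOn_of_continuous
    (hu.mono fun w hw => ⟨mem_univ _, hw.2.1⟩)
  obtain ⟨τ, hτ, h⟩ := Metric.uniformContinuousOn_iff.1 huc θ hθ
  refine ⟨τ, hτ, fun p hp t ht htτ => ?_⟩
  rw [← Real.dist_eq]
  have hp' : p ∈ Metric.closedBall (0 : Heisenberg) R := mem_closedBall_zero_iff.2 hp
  refine h (p, t) ⟨hp', ht⟩ (p, 0) ⟨hp', le_rfl, ht.1.trans ht.2⟩ ?_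
  rw [Prod.dist_eq, dist_self, Real.dist_eq, sub_zero, abs_of_nonneg ht.1]
  exact max_lt hτ htτ

namespace Heisenberg

/-! ### Doubling of variables and comparison. -/

/-- The function maximised in the doubling of variables: `λ`, `δ` and `σ` weigh the distance
of the two points, their distance to the origin and the distance of the two times. -/
noncomputable def doubled (u v : Heisenberg × ℝ → ℝ) (lam δ σ : ℝ) (β : ℝ → ℝ)
    (P : (Heisenberg × ℝ) × (Heisenberg × ℝ)) : ℝ :=
  u P.1 - v P.2 - lam * gaugePow (P.1.1⁻¹ * P.2.1) - δ * gaugePow P.1.1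
    - σ * (P.1.2 - P.2.2) ^ 2 - β P.1.2 - β P.2.2

/-- The doubled function attains its maximum over a slab on which it is positive somewhere. -/
theorem exists_max_doubled {u v : Heisenberg × ℝ → ℝ} (hu : ContinuousOn u (univ ×ˢ Ici 0))
    (hv : ContinuousOn v (univ ×ˢ Ici 0)) {lam δ σ T D R : ℝ} {β : ℝ → ℝ} (hβ : Continuous β)
    (hR : ∀ p q : Heisenberg, gaugePow p ≤ D / δ → gaugePow (p⁻¹ * q) ≤ D / lam →
      ‖p‖ ≤ R ∧ ‖q‖ ≤ R)
    (hbd : ∀ P : (Heisenberg × ℝ) × (Heisenberg × ℝ), P.1.2 ∈ Icc 0 T → P.2.2 ∈ Icc 0 T →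
      0 < doubled u v lam δ σ β P →
      gaugePow P.1.1 ≤ D / δ ∧ gaugePow (P.1.1⁻¹ * P.2.1) ≤ D / lam)
    {P₀ : (Heisenberg × ℝ) × (Heisenberg × ℝ)} (h1 : P₀.1.2 ∈ Icc 0 T) (h2 : P₀.2.2 ∈ Icc 0 T)
    (h0 : 0 < doubled u v lam δ σ β P₀) :
    ∃ P : (Heisenberg × ℝ) × (Heisenberg × ℝ), P.1.2 ∈ Icc 0 T ∧ P.2.2 ∈ Icc 0 T ∧
      ∀ Q : (Heisenberg × ℝ) × (Heisenberg × ℝ), Q.1.2 ∈ Icc 0 T → Q.2.2 ∈ Icc 0 T →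
        doubled u v lam δ σ β Q ≤ doubled u v lam δ σ β P := by
  set B := Metric.closedBall (0 : Heisenberg) R ×ˢ Icc (0 : ℝ) T
  have hB : IsCompact B := (isCompact_closedBall _ _).prod isCompact_Icc
  have hmem : ∀ P : (Heisenberg × ℝ) × (Heisenberg × ℝ), P.1.2 ∈ Icc 0 T → P.2.2 ∈ Icc 0 T →
      0 < doubled u v lam δ σ β P → P ∈ B ×ˢ B := fun P hP1 hP2 hP => by
    obtain ⟨ha, hb⟩ := hbd P hP1 hP2 hP
    obtain ⟨hp, hq⟩ := hR _ _ ha hb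
    exact ⟨⟨mem_closedBall_zero_iff.2 hp, hP1⟩, ⟨mem_closedBall_zero_iff.2 hq, hP2⟩⟩
  have hsub : ∀ w ∈ B, w ∈ (univ : Set Heisenberg) ×ˢ Ici (0 : ℝ) :=
    fun w hw => ⟨mem_univ _, hw.2.1⟩
  have hcu : ContinuousOn (fun P : (Heisenberg × ℝ) × (Heisenberg × ℝ) => u P.1) (B ×ˢ B) :=
    hu.comp continuousOn_fst fun P hP => hsub _ hP.1
  have hcv : ContinuousOn (fun P : (Heisenberg × ℝ) × (Heisenberg × ℝ) => v P.2) (B ×ˢ B) :=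
    hv.comp continuousOn_snd fun P hP => hsub _ hP.2
  have hK : Continuous (fun P : (Heisenberg × ℝ) × (Heisenberg × ℝ) =>
      gaugePow (P.1.1⁻¹ * P.2.1)) :=
    continuous_gaugePow_inv_mul.comp (f := fun P : (Heisenberg × ℝ) × (Heisenberg × ℝ) =>
      (P.1.1, P.2.1)) (by fun_prop)
  have hc : ContinuousOn (doubled u v lam δ σ β) (B ×ˢ B) := by
    unfold doubled
    exact (((((hcu.sub hcv).sub (continuous_const.mul hK).continuousOn).sub
      (by fun_prop)).sub (by fun_prop)).sub (by fun_prop)).sub (by fun_prop)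
  obtain ⟨P, hP, hmax⟩ := (hB.prod hB).exists_isMaxOn ⟨P₀, hmem P₀ h1 h2 h0⟩ hc
  refine ⟨P, hP.1.2, hP.2.2, fun Q hQ1 hQ2 => ?_⟩
  by_cases hQ : 0 < doubled u v lam δ σ β Q
  · exact hmax (hmem Q hQ1 hQ2 hQ)
  · exact (not_lt.1 hQ).trans (h0.le.trans (hmax (hmem P₀ h1 h2 h0)))

/-- The inequalities given by the equation at an interior maximum of the doubled function. -/
theorem le_of_max_doubled {m : ℝ → ℝ} {u v : Heisenberg × ℝ → ℝ}
    (hu : IsViscositySubsolution m u) (hv : IsViscositySupersolution m v)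
    {lam δ σ T : ℝ} {β : ℝ → ℝ} (hβ : ContDiff ℝ 2 β) {p q : Heisenberg} {t s : ℝ}
    (ht : t ∈ Ioo 0 T) (hs : s ∈ Ioo 0 T)
    (hmax : ∀ Q : (Heisenberg × ℝ) × (Heisenberg × ℝ), Q.1.2 ∈ Icc 0 T → Q.2.2 ∈ Icc 0 T →
        doubled u v lam δ σ β Q ≤ doubled u v lam δ σ β ((p, t), (q, s))) :
    deriv β t + deriv β s ≤ m ‖lam • gaugePowGradient (p⁻¹ * q)‖ -
      m ‖lam • gaugePowGradient (q⁻¹ * p) + δ • gaugePowGradient p‖ := by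
  have hd : ∀ r, HasDerivAt β (deriv β r) r := fun r =>
    (hβ.differentiable two_ne_zero r).hasDerivAt
  have hsq : ∀ c r : ℝ, HasDerivAt (fun r => σ * (r - c) ^ 2) (σ * (2 * (r - c))) r := fun c r => by
    have := (((hasDerivAt_id r).sub_const c).pow 2).const_mul σ
    simpa using this
  have near : ∀ (r : Heisenberg) {τ : ℝ}, τ ∈ Ioo 0 T →
      ∀ᶠ w : Heisenberg × ℝ in 𝓝 (r, τ), w.2 ∈ Icc 0 T := fun r τ hτ =>
    continuous_snd.continuousAt.eventually (Icc_mem_nhds hτ.1 hτ.2)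
  have hsub := hu.2 (fun w => lam * gaugePow (q⁻¹ * w.1) + δ * gaugePow (1 * w.1) +
      (σ * (w.2 - s) ^ 2 + β w.2)) p t ht.1
    (contDiff_testFunction (g := fun r => σ * (r - s) ^ 2 + β r) lam δ q⁻¹ 1
      (by fun_prop)).contDiffAt (by
      filter_upwards [near p ht] with w hw
      have h := hmax (w, (q, s)) hw (Ioo_subset_Icc_self hs)
      simp only [doubled, gaugePow_inv_mul_comm _ q] at h
      simp only [one_mul]
      linarith)
  have hsup := hv.2 (fun w => (-lam) * gaugePow (p⁻¹ * w.1) + 0 * gaugePow (1 * w.1) +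
      (-(σ * (w.2 - t) ^ 2 + β w.2))) q s hs.1
    (contDiff_testFunction (g := fun r => -(σ * (r - t) ^ 2 + β r)) (-lam) 0 p⁻¹ 1
      (by fun_prop)).contDiffAt (by
      filter_upwards [near q hs] with w hw
      have h := hmax ((p, t), w) (Ioo_subset_Icc_self ht) hw
      simp only [doubled] at h
      have e1 : (t - w.2) ^ 2 = (w.2 - t) ^ 2 := by ring
      have e2 : (t - s) ^ 2 = (s - t) ^ 2 := by ring
      rw [e1, e2] at h
      linarith)
  rw [hamiltonJacobi_gaugePow (g := fun r => σ * (r - s) ^ 2 + β r) m lam δ q⁻¹ 1 p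
    ((hsq s t).add (hd t)), one_mul] at hsub
  rw [hamiltonJacobi_gaugePow (g := fun r => -(σ * (r - t) ^ 2 + β r)) m (-lam) 0 p⁻¹ 1 q
    ((hsq t s).add (hd s)).neg, zero_smul, add_zero, neg_smul, norm_neg] at hsup
  -- The derivatives 2σ(t - s) of the time penalty agree in the two inequalities and cancel.
  linarith

/-- Comparison of a subsolution and a supersolution at different points, the difference of which
is controlled at time `0` by the fourth power of the distance. -/
theorem sub_le_gaugePow {m : ℝ → ℝ} (hm : Continuous m) {u v : Heisenberg × ℝ → ℝ}
    (hu : IsViscositySubsolution m u) (hv : IsViscositySupersolution m v)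
    (hcu : ContinuousOn u (univ ×ˢ Ici 0)) (hcv : ContinuousOn v (univ ×ˢ Ici 0))
    {lam c t₀ C : ℝ} (hlam : 0 < lam) (hc : 0 ≤ c) (ht₀ : 0 ≤ t₀)
    (hbu : ∀ p : Heisenberg, ∀ t ∈ Icc 0 (t₀ + 1), |u (p, t)| ≤ C)
    (hbv : ∀ p : Heisenberg, ∀ t ∈ Icc 0 (t₀ + 1), |v (p, t)| ≤ C)
    (h0 : ∀ p q : Heisenberg, u (p, 0) - v (q, 0) ≤ c + lam * gaugePow (p⁻¹ * q))
    (p₀ q₀ : Heisenberg) :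
    u (p₀, t₀) - v (q₀, t₀) ≤ c + lam * gaugePow (p₀⁻¹ * q₀) := by
  by_contra! hlt
  set T := t₀ + 1 with hT
  have hC : 0 ≤ C := (abs_nonneg _).trans (hbu 1 0 ⟨le_rfl, by linarith⟩)
  -- Of the gap 5θ, the barriers at t₀ cost 2θ and the localisation at most θ, so the maximum is at
  -- least c + 2θ. A maximum at time 0 would have value below c + θ.
  obtain ⟨θ, hθ, hgap⟩ : ∃ θ > 0,
      c + lam * gaugePow (p₀⁻¹ * q₀) + 5 * θ = u (p₀, t₀) - v (q₀, t₀) :=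
    ⟨(u (p₀, t₀) - v (q₀, t₀) - (c + lam * gaugePow (p₀⁻¹ * q₀))) / 5, by linarith, by ring⟩
  set D := 2 * C with hD
  -- the barrier in time
  obtain ⟨B, hB, hBD⟩ : ∃ B : ℝ, 0 < B ∧ D < θ * Real.exp B := by
    refine ⟨D / θ + 1, by positivity, ?_⟩
    have h := Real.add_one_le_exp (D / θ + 1)
    have h' : θ * (D / θ) = D := by field_simp
    nlinarith
  set β : ℝ → ℝ := fun t => θ * Real.exp (B * (t - t₀)) with hβdef
  have hβ : ContDiff ℝ 2 β := by fun_prop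
  have hβpos : ∀ t, 0 ≤ β t := fun t => by positivity
  have hβt₀ : β t₀ = θ := by simp [β]
  -- Since T = t₀ + 1, the barrier at T exceeds every possible value of u - v, which rules out
  -- maxima at the final time.
  have hβT : D < β T := by simpa [β, T] using hBD
  set ω := θ * B * Real.exp (-(B * t₀)) with hω
  have hωpos : 0 < ω := by positivity
  have hβ' : ∀ t, 0 ≤ t → ω ≤ deriv β t := fun t ht => by
    have h1 : HasDerivAt β (θ * (Real.exp (B * (t - t₀)) * (B * 1))) t :=
      ((((hasDerivAt_id t).sub_const t₀).const_mul B).exp).const_mul θ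
    rw [h1.deriv, hω]
    have h2 : Real.exp (-(B * t₀)) ≤ Real.exp (B * (t - t₀)) :=
      Real.exp_le_exp.2 (by nlinarith)
    nlinarith [mul_le_mul_of_nonneg_left h2 (by positivity : 0 ≤ θ * B)]
  -- the gradient bound and the modulus of continuity of `m`
  set G := lam * (1 + 256 * (D / lam) ^ 3) with hG
  obtain ⟨ρ, hρ, hmod⟩ := exists_uniform_modulus_of_continuous hm G hωpos
  -- The gradient bound G does not involve δ, so ρ could be fixed before δ.
  obtain ⟨δ, hδ, hδρ, hδp⟩ : ∃ δ > 0, 256 * δ * D ^ 3 ≤ ρ ^ 4 ∧ δ * gaugePow p₀ ≤ θ := by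
    have hK := gaugePow_nonneg p₀
    have hD0 : 0 ≤ D := by positivity
    refine ⟨min (ρ ^ 4 / (256 * D ^ 3 + 1)) (θ / (gaugePow p₀ + 1)), by positivity, ?_, ?_⟩
    · have h := min_le_left (ρ ^ 4 / (256 * D ^ 3 + 1)) (θ / (gaugePow p₀ + 1))
      rw [le_div_iff₀ (by positivity)] at h
      have : 0 < min (ρ ^ 4 / (256 * D ^ 3 + 1)) (θ / (gaugePow p₀ + 1)) := by positivity
      nlinarith
    · have h := min_le_right (ρ ^ 4 / (256 * D ^ 3 + 1)) (θ / (gaugePow p₀ + 1))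
      rw [le_div_iff₀ (by positivity)] at h
      have : 0 < min (ρ ^ 4 / (256 * D ^ 3 + 1)) (θ / (gaugePow p₀ + 1)) := by positivity
      nlinarith
  obtain ⟨R, hR⟩ := exists_norm_le_of_gaugePow_le (D / δ) (D / lam)
  obtain ⟨τu, hτu, hmu⟩ := exists_uniform_modulus_initial hcu R T hθ
  obtain ⟨τv, hτv, hmv⟩ := exists_uniform_modulus_initial hcv R T hθ
  obtain ⟨τ, hτ, hτu', hτv'⟩ : ∃ τ > 0, τ ≤ τu ∧ τ ≤ τv :=
    ⟨min τu τv, lt_min hτu hτv, min_le_left _ _, min_le_right _ _⟩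
  -- This forces |t - s| < τ at the maximum, so if one time is 0 the other lies within the initial
  -- modulus.
  obtain ⟨σ, hσ, hστ⟩ : ∃ σ > 0, D < σ * τ ^ 2 :=
    ⟨(D + 1) / τ ^ 2, by positivity, by rw [div_mul_cancel₀ _ (by positivity)]; linarith⟩
  -- all penalties are bounded where the doubled function is positive
  have hpen : ∀ (p q : Heisenberg) (t s : ℝ), t ∈ Icc 0 T → s ∈ Icc 0 T →
      0 < doubled u v lam δ σ β ((p, t), (q, s)) →
      lam * gaugePow (p⁻¹ * q) + δ * gaugePow p + σ * (t - s) ^ 2 + β t + β s < D :=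
    fun p q t s ht hs h => by
      have h1 := (abs_le.1 (hbu p t ht)).2
      have h2 := (abs_le.1 (hbv q s hs)).1
      simp only [doubled] at h
      linarith
  have hbd : ∀ P : (Heisenberg × ℝ) × (Heisenberg × ℝ), P.1.2 ∈ Icc 0 T → P.2.2 ∈ Icc 0 T →
      0 < doubled u v lam δ σ β P →
      gaugePow P.1.1 ≤ D / δ ∧ gaugePow (P.1.1⁻¹ * P.2.1) ≤ D / lam := by
    rintro ⟨⟨p, t⟩, ⟨q, s⟩⟩ ht hs h
    have h1 := hpen p q t s ht hs h
    have h2 := mul_nonneg hlam.le (gaugePow_nonneg (p⁻¹ * q))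
    have h3 := mul_nonneg hδ.le (gaugePow_nonneg p)
    have h4 := mul_nonneg hσ.le (sq_nonneg (t - s))
    constructor
    · rw [le_div_iff₀ hδ]; linarith [hβpos t, hβpos s]
    · rw [le_div_iff₀ hlam]; linarith [hβpos t, hβpos s]
  have ht₀T : t₀ ∈ Icc 0 T := ⟨ht₀, by linarith⟩
  have hval : c + 2 * θ ≤ doubled u v lam δ σ β ((p₀, t₀), (q₀, t₀)) := by
    simp only [doubled, hβt₀, sub_self]
    linarith
  obtain ⟨⟨⟨p, t⟩, ⟨q, s⟩⟩, ht, hs, hmax⟩ := exists_max_doubled hcu hcv hβ.continuous hR hbd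
    (P₀ := ((p₀, t₀), (q₀, t₀))) ht₀T ht₀T (by linarith)
  dsimp only at ht hs
  have hmaxval := hval.trans (hmax _ ht₀T ht₀T)
  have hpos : 0 < doubled u v lam δ σ β ((p, t), (q, s)) := by linarith
  obtain ⟨hKp, hKw⟩ := hbd _ ht hs hpos
  dsimp only at hKp hKw
  obtain ⟨hRp, hRq⟩ := hR p q hKp hKw
  have hpen' := hpen p q t s ht hs hpos
  have n2 := mul_nonneg hlam.le (gaugePow_nonneg (p⁻¹ * q))
  have n3 := mul_nonneg hδ.le (gaugePow_nonneg p)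
  have n4 := mul_nonneg hσ.le (sq_nonneg (t - s))
  have nt := hβpos t
  have ns := hβpos s
  have hts : |t - s| < τ := by
    refine lt_of_pow_lt_pow_left₀ 2 hτ.le ?_
    rw [sq_abs]
    nlinarith
  have htT : t < T := ht.2.lt_of_ne fun h => by rw [h] at hpen' n4 nt; linarith
  have hsT : s < T := hs.2.lt_of_ne fun h => by rw [h] at hpen' n4 ns; linarith
  simp only [doubled] at hmaxval
  have ht0 : 0 < t := ht.1.lt_of_ne fun h => by
    subst h
    rw [zero_sub, abs_neg, abs_of_nonneg hs.1] at hts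
    have h1 := (abs_lt.1 (hmv q hRq s hs (by linarith))).1
    linarith [h0 p q]
  have hs0 : 0 < s := hs.1.lt_of_ne fun h => by
    subst h
    rw [sub_zero, abs_of_nonneg ht.1] at hts
    have h1 := (abs_lt.1 (hmu p hRp t ht (by linarith))).2
    linarith [h0 p q]
  have key := le_of_max_doubled hu hv hβ ⟨ht0, htT⟩ ⟨hs0, hsT⟩ hmax
  have hnorm : ‖lam • gaugePowGradient (q⁻¹ * p)‖ = ‖lam • gaugePowGradient (p⁻¹ * q)‖ := by
    rw [norm_smul, norm_smul, ← norm_gaugePowGradient_inv (q⁻¹ * p), mul_inv_rev, inv_inv]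
  have hgrad : |‖lam • gaugePowGradient (p⁻¹ * q)‖| ≤ G := by
    rw [abs_norm, norm_smul, Real.norm_of_nonneg hlam.le]
    refine mul_le_mul_of_nonneg_left ?_ hlam.le
    have h1 := norm_gaugePowGradient_pow_four_le (p⁻¹ * q)
    have h2 : gaugePow (p⁻¹ * q) ^ 3 ≤ (D / lam) ^ 3 :=
      pow_le_pow_left₀ (gaugePow_nonneg _) hKw 3
    linarith [le_one_add_pow_four ‖gaugePowGradient (p⁻¹ * q)‖]
  have hpert : ‖δ • gaugePowGradient p‖ ≤ ρ := by
    refine le_of_pow_le_pow_left₀ (n := 4) (by norm_num) hρ.le ?_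
    rw [norm_smul, Real.norm_of_nonneg hδ.le, mul_pow]
    have h1 := norm_gaugePowGradient_pow_four_le p
    have h2 : (δ * gaugePow p) ^ 3 ≤ D ^ 3 := pow_le_pow_left₀ n3 (by linarith) 3
    calc δ ^ 4 * ‖gaugePowGradient p‖ ^ 4 ≤ δ ^ 4 * (256 * gaugePow p ^ 3) := by gcongr
      _ = 256 * δ * (δ * gaugePow p) ^ 3 := by ring
      _ ≤ 256 * δ * D ^ 3 := by gcongr
      _ ≤ ρ ^ 4 := hδρ
  have hclose : |‖lam • gaugePowGradient (p⁻¹ * q)‖ -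
      ‖lam • gaugePowGradient (q⁻¹ * p) + δ • gaugePowGradient p‖| ≤ ρ := by
    rw [← hnorm]
    refine (abs_norm_sub_norm_le _ _).trans ?_
    rwa [sub_add_cancel_left, norm_neg]
  have h1 := (abs_lt.1 (hmod _ _ hgrad hclose)).2
  -- The barrier derivatives sum to at least 2ω, the Hamiltonians differ by less than ω.
  linarith [hβ' t ht.1, hβ' s hs.1]

/-! ### From quartic bounds to the Lipschitz bound. -/

/-- Two solutions with the same Lipschitz initial value differ, at two points, by at most the
Lipschitz bound. -/
theorem sub_le_dL {m : ℝ → ℝ} (hm : Continuous m) {u₀ : Heisenberg → ℝ}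
    {u v : Heisenberg × ℝ → ℝ} (hu : IsBoundedViscositySolution m u₀ u)
    (hv : IsBoundedViscositySolution m u₀ v) {L : ℝ} (hL : 0 < L)
    (hLip : ∀ p q : Heisenberg, |u₀ p - u₀ q| ≤ L * dL p q) {t : ℝ} (ht : 0 ≤ t)
    (p q : Heisenberg) : u (p, t) - v (q, t) ≤ L * dL p q := by
  have young : ∀ κ > 0, u (p, t) - v (q, t) ≤
      3 * L * κ / 4 + L / (4 * κ ^ 3) * gaugePow (p⁻¹ * q) := fun κ hκ => by
    obtain ⟨Cu, hCu⟩ := hu.bounded (t + 2) (by linarith)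
    obtain ⟨Cv, hCv⟩ := hv.bounded (t + 2) (by linarith)
    refine sub_le_gaugePow (C := max Cu Cv) hm hu.subsolution hv.supersolution hu.continuousOn
      hv.continuousOn (by positivity) (by positivity) ht
      (fun p s hs => (hCu p s ⟨hs.1, by linarith [hs.2]⟩).trans (le_max_left _ _))
      (fun p s hs => (hCv p s ⟨hs.1, by linarith [hs.2]⟩).trans (le_max_right _ _))
      (fun p q => ?_) p q
    rw [hu.initial, hv.initial]
    refine ((le_abs_self _).trans (hLip p q)).trans ?_
    rw [← gauge_pow_four]
    change L * dL p q ≤ 3 * L * κ / 4 + L / (4 * κ ^ 3) * dL p q ^ 4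
    have hd := dL_nonneg p q
    -- Young's inequality as the factorisation d⁴ - 4κ³d + 3κ⁴ = (d - κ)²(d² + 2dκ + 3κ²).
    have e : 3 * L * κ / 4 + L / (4 * κ ^ 3) * dL p q ^ 4 - L * dL p q =
        L / (4 * κ ^ 3) * ((dL p q - κ) ^ 2 * (dL p q ^ 2 + 2 * dL p q * κ + 3 * κ ^ 2)) := by
      field_simp
      ring
    have : 0 ≤ L / (4 * κ ^ 3) *
        ((dL p q - κ) ^ 2 * (dL p q ^ 2 + 2 * dL p q * κ + 3 * κ ^ 2)) := by positivity
    linarith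
  rw [← gauge_pow_four] at young
  change ∀ κ > 0, _ ≤ 3 * L * κ / 4 + L / (4 * κ ^ 3) * dL p q ^ 4 at young
  rcases (dL_nonneg p q).eq_or_lt with h | h
  · rw [← h, mul_zero]
    refine le_of_forall_pos_le_add fun ε hε => ?_
    -- At distance 0 only 3Lκ/4 remains, and this κ makes it ε.
    have := young (4 * ε / (3 * L)) (by positivity)
    rw [← h] at this
    refine this.trans_eq ?_
    field_simp
    ring
  -- The optimal κ is d itself, where Young's inequality is an equality.
  · refine (young _ h).trans_eq ?_
    field_simp
    ring

end Heisenberg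

theorem theorem4p3 (m : ℝ → ℝ) (hm : LocallyUniformlyContinuous m)
    (u₀ : Heisenberg → ℝ) (hu₀ : ∃ M : ℝ, ∀ p : Heisenberg, |u₀ p| ≤ M)
    (u : Heisenberg × ℝ → ℝ) (hu : Heisenberg.IsBoundedViscositySolution m u₀ u)
    (L : ℝ) (hL : 0 < L)
    (hLip : ∀ p q : Heisenberg, |u₀ p - u₀ q| ≤ L * Heisenberg.dL p q) :
    (∀ v : Heisenberg × ℝ → ℝ, Heisenberg.IsBoundedViscositySolution m u₀ v →
      ∀ (p : Heisenberg) (t : ℝ), 0 ≤ t → v (p, t) = u (p, t)) ∧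
    ∀ t : ℝ, 0 ≤ t → ∀ p q : Heisenberg,
      |u (p, t) - u (q, t)| ≤ L * Heisenberg.dL p q := by
  have hc := hm.continuous
  constructor
  · intro v hv p t ht
    have h1 := Heisenberg.sub_le_dL hc hu hv hL hLip ht p p
    have h2 := Heisenberg.sub_le_dL hc hv hu hL hLip ht p p
    rw [Heisenberg.dL_self, mul_zero] at h1 h2
    linarith
  · intro t ht p q
    have h1 := Heisenberg.sub_le_dL hc hu hu hL hLip ht p q
    have h2 := Heisenberg.sub_le_dL hc hu hu hL hLip ht q p
    rw [Heisenberg.dL_comm q p] at h2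
    exact abs_sub_le_iff.2 ⟨h1, h2⟩
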